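/- All graphs are finite and simple. For a graph $G=(V,E)$, a set $D\subseteq V$ is dominating if every vertex of $G$ belongs to $D$ or is adjacent to a vertex of $D$; the domination number $\gamma(G)$ is the minimum cardinality of a dominating set. If $E\neq\emptyset$, the bondage number $b(G)$ is the minimum cardinality of a set of edges $E'\subseteq E$ such that $\gamma(G-E')>\gamma(G)$. The strong product $G\boxtimes H$ of graphs $G$ and $H$ has vertex set $V(G)\times V(H)$, and $(v,u)$, $(v',u')$ are adjacent if and only if ($v=v'$ and $u\sim u'$), or ($v\sim v'$ and $u=u'$), or ($v\sim v'$ and $u\sim u'$). Let $P_k$ denote the path on $k$ vertices. **Theorem.** Let $n,m\ge 2$ be integers with $n=3t+1$ and $m=3r+2$ for some integers $t,r\ge 0$. Then $$b(P_n\boxtimes P_m)=3.$$ -/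

import Mathlib

namespace SimpleGraph

/-- The strong product `G ⊠ H`: `(a, b)` and `(c, d)` are adjacent iff `a = c` and `b ∼ d`,
or `a ∼ c` and `b = d`, or `a ∼ c` and `b ∼ d`. -/
def strongProduct {α β : Type*} (G : SimpleGraph α) (H : SimpleGraph β) :
    SimpleGraph (α × β) where
  Adj x y := (x.1 = y.1 ∧ H.Adj x.2 y.2) ∨ (G.Adj x.1 y.1 ∧ x.2 = y.2) ∨
    (G.Adj x.1 y.1 ∧ H.Adj x.2 y.2)
  symm := ⟨by
    rintro x y (⟨h, h'⟩ | ⟨h, h'⟩ | ⟨h, h'⟩)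
    · exact Or.inl ⟨h.symm, h'.symm⟩
    · exact Or.inr (Or.inl ⟨h.symm, h'.symm⟩)
    · exact Or.inr (Or.inr ⟨h.symm, h'.symm⟩)⟩
  loopless := ⟨by
    rintro x (⟨_, h⟩ | ⟨h, _⟩ | ⟨h, _⟩)
    · exact H.irrefl h
    · exact G.irrefl h
    · exact G.irrefl h⟩

/-- `D` is a dominating set of `G`: every vertex lies in `D` or is adjacent to a vertex of `D`,
that is, the closed neighborhood of `D` is the whole vertex set. -/
def IsDominatingSet {V : Type*} (G : SimpleGraph V) (D : Finset V) : Prop :=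
  ∀ v : V, v ∈ D ∨ ∃ u ∈ D, G.Adj u v

/-- The domination number `γ(G)` of a finite graph: the minimum cardinality of a dominating set.
The infimum is over a nonempty set, since the whole vertex set is dominating. -/
noncomputable def dominationNumber {V : Type*} [Fintype V] (G : SimpleGraph V) : ℕ :=
  sInf {k : ℕ | ∃ D : Finset V, G.IsDominatingSet D ∧ D.card = k}

/-- The bondage number `b(G)` of a finite graph with at least one edge: the minimum cardinality
of a set of edges `F` of `G` with `γ(G - F) > γ(G)`. (The value is `0`, a junk value, exactly when
no such `F` exists.) -/
noncomputable def bondageNumber {V : Type*} [Fintype V] (G : SimpleGraph V) : ℕ :=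
  sInf {k : ℕ | ∃ F : Finset (Sym2 V), (F : Set (Sym2 V)) ⊆ G.edgeSet ∧
    G.dominationNumber < (G.deleteEdges (F : Set (Sym2 V))).dominationNumber ∧ F.card = k}

end SimpleGraph

/-! The vertices `(3 i, 3 j + 1)` have disjoint closed neighbourhoods, so `γ ≥ (t + 1)(r + 1)`.
Cutting the three edges at the corner `(0, 0)` lets the corner join this packing, so three edges
suffice. Two edges do not. Rows `3 j` and rows `3 j + 1` (`j ≤ r`) both dominate all rows, and in
each row `t + 1` vertices dominate its strip with two columns of slack. That slack absorbs any
single edge (`stripCover_of_subsingleton`), so both families fail only if both deleted edges join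
rows `c = 3 j` and `c + 1`. An edge from column `p` to column `q` then obstructs row `c` as `(p, q)`
and row `c + 1` as `(q, p)`, and one of the two rows still works (`hasColumnCover_or_flip`). -/

/-! ### Covering a path by columns with two forbidden pairs -/

/-- The columns `3 i + 1` for `i < j`, `3 i` for `j ≤ i < k`, and `3 i - 1` for `k ≤ i`. -/
def shiftedColumns (j k i : ℕ) : ℕ :=
  if i < j then 3 * i + 1 else if i < k then 3 * i else 3 * i - 1

/-- There are `t + 1` columns in `{0, …, 3 t}` dominating every column, where a column `p₁` does
not dominate `q₁` and `p₂` does not dominate `q₂`. -/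
def HasColumnCover (t p₁ q₁ p₂ q₂ : ℕ) : Prop :=
  ∃ d : ℕ → ℕ, (∀ i ≤ t, d i ≤ 3 * t) ∧ ∀ a ≤ 3 * t, ∃ i ≤ t, d i ≤ a + 1 ∧ a ≤ d i + 1 ∧
    ¬ (d i = p₁ ∧ a = q₁) ∧ ¬ (d i = p₂ ∧ a = q₂)

/-- Only indices `a / 3` and `a / 3 + 1` can give a column within distance `1` of `a`. -/
theorem hasColumnCover_of_shiftedColumns {t p₁ q₁ p₂ q₂ : ℕ} (j k : ℕ)
    (hk : 1 ≤ k) (hj : j ≤ t)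
    (h : ∀ a ≤ 3 * t, ∀ x y, x = shiftedColumns j k (a / 3) →
      y = shiftedColumns j k (a / 3 + 1) →
      (x ≤ a + 1 ∧ a ≤ x + 1 ∧ ¬ (x = p₁ ∧ a = q₁) ∧ ¬ (x = p₂ ∧ a = q₂)) ∨
      (a / 3 + 1 ≤ t ∧ y ≤ a + 1 ∧ a ≤ y + 1 ∧ ¬ (y = p₁ ∧ a = q₁) ∧ ¬ (y = p₂ ∧ a = q₂))) :
    HasColumnCover t p₁ q₁ p₂ q₂ := by
  refine ⟨shiftedColumns j k, fun i hi => ?_, fun a ha => ?_⟩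
  · unfold shiftedColumns; split_ifs <;> omega
  · rcases h a ha _ _ rfl rfl with h | h
    · exact ⟨a / 3, by omega, h⟩
    · exact ⟨a / 3 + 1, h⟩

theorem hasColumnCover_pair_of_mod_eq_zero {t p₁ q₁ p₂ q₂ : ℕ} (ht : 1 ≤ t)
    (h₁ : p₁ % 3 = 0) (h₂ : p₂ % 3 = 0) : HasColumnCover t p₁ q₁ p₂ q₂ := by
  -- Columns `1, 4, …, 3 t - 2, 3 t - 1`: no multiple of `3`.
  refine hasColumnCover_of_shiftedColumns t t ht le_rfl fun a ha x y hx hy => ?_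
  unfold shiftedColumns at hx hy
  split_ifs at hx hy <;> omega

theorem hasColumnCover_pair_of_mod_ne_zero {t p₁ q₁ p₂ q₂ : ℕ} (ht : 1 ≤ t)
    (h₁ : p₁ % 3 ≠ 0) (h₂ : p₂ % 3 ≠ 0) : HasColumnCover t p₁ q₁ p₂ q₂ := by
  refine hasColumnCover_of_shiftedColumns 0 (t + 1) (by omega) (by omega)
    fun a ha x y hx hy => ?_
  unfold shiftedColumns at hx hy
  split_ifs at hx hy <;> omega

theorem hasColumnCover_single {t : ℕ} (p q : ℕ) (ht : 1 ≤ t) : HasColumnCover t p q p q := by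
  by_cases h : p % 3 = 0
  · exact hasColumnCover_pair_of_mod_eq_zero ht h h
  · exact hasColumnCover_pair_of_mod_ne_zero ht h h

theorem hasColumnCover_swap_succ {t p : ℕ} (ht : 1 ≤ t) (hp : p + 1 ≤ 3 * t) :
    HasColumnCover t p (p + 1) (p + 1) p := by
  by_cases h : p % 3 = 1
  · exact hasColumnCover_pair_of_mod_ne_zero ht (by omega) (by omega)
  -- The only chosen multiple of `3` is whichever of `p`, `p + 1` is one; the other is not chosen
  -- and has a second dominator on its far side.
  · refine hasColumnCover_of_shiftedColumns ((p + 1) / 3) ((p + 1) / 3 + 1) (by omega)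
      (by omega) fun a ha x y hx hy => ?_
    unfold shiftedColumns at hx hy
    split_ifs at hx hy <;> omega

theorem HasColumnCover.symm {t p₁ q₁ p₂ q₂ : ℕ} (h : HasColumnCover t p₁ q₁ p₂ q₂) :
    HasColumnCover t p₂ q₂ p₁ q₁ := by
  obtain ⟨d, hd, h⟩ := h
  refine ⟨d, hd, fun a ha => ?_⟩
  obtain ⟨i, hi, h₁, h₂, h₃, h₄⟩ := h a ha
  exact ⟨i, hi, h₁, h₂, h₄, h₃⟩

theorem hasColumnCover_swap {t p q : ℕ} (ht : 1 ≤ t) (hp : p ≤ 3 * t) (hq : q ≤ 3 * t)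
    (hpq : p + 1 = q ∨ q + 1 = p) : HasColumnCover t p q q p := by
  rcases hpq with rfl | rfl
  · exact hasColumnCover_swap_succ ht hq
  · exact (hasColumnCover_swap_succ ht hp).symm

theorem hasColumnCover_or_flip_of_mod {t p₁ q₁ p₂ q₂ : ℕ} (ht : 1 ≤ t)
    (hp₁ : p₁ ≤ 3 * t) (hp₂ : p₂ ≤ 3 * t) (hq₁ : q₁ ≤ 3 * t)
    (h₁ : p₁ ≤ q₁ + 1 ∧ q₁ ≤ p₁ + 1) (h₂ : p₂ ≤ q₂ + 1 ∧ q₂ ≤ p₂ + 1)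
    (hm₁ : p₁ % 3 = 0) :
    HasColumnCover t p₁ q₁ p₂ q₂ ∨ HasColumnCover t q₁ p₁ q₂ p₂ := by
  by_cases hm : p₂ % 3 = 1
  · by_cases h : p₂ = 1 ∧ q₂ = 0
    · by_cases h' : p₁ = 0 ∧ q₁ = 0
      · exact .inr (hasColumnCover_pair_of_mod_eq_zero ht (by omega) (by omega))
      -- Columns `0, 2, 5, …, 3 t - 1`: only `p₁ = 0` can be hit, and then `q₁ = 1` is also
      -- dominated by `2`.
      · left
        refine hasColumnCover_of_shiftedColumns 0 1 (by omega) (by omega)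
          fun a ha x y hx hy => ?_
        unfold shiftedColumns at hx hy
        split_ifs at hx hy <;> omega
    -- Columns `1, 2, 5, …, 3 t - 1`: among those congruent to `1`, only `1` occurs, and it is
    -- needed only for column `0`. The remaining cases mirror these at the right end.
    · left
      refine hasColumnCover_of_shiftedColumns 1 1 (by omega) (by omega)
        fun a ha x y hx hy => ?_
      unfold shiftedColumns at hx hy
      split_ifs at hx hy <;> omega
  · by_cases h : p₂ = 3 * t - 1 ∧ q₂ = 3 * t
    · by_cases h' : p₁ = 3 * t ∧ q₁ = 3 * t
      · exact .inr (hasColumnCover_pair_of_mod_eq_zero ht (by omega) (by omega))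
      · left
        refine hasColumnCover_of_shiftedColumns t (t + 1) (by omega) (by omega)
          fun a ha x y hx hy => ?_
        unfold shiftedColumns at hx hy
        split_ifs at hx hy <;> omega
    · left
      refine hasColumnCover_of_shiftedColumns t t (by omega) (by omega)
        fun a ha x y hx hy => ?_
      unfold shiftedColumns at hx hy
      split_ifs at hx hy <;> omega

theorem hasColumnCover_or_flip {t p₁ q₁ p₂ q₂ : ℕ} (ht : 1 ≤ t)
    (hp₁ : p₁ ≤ 3 * t) (hp₂ : p₂ ≤ 3 * t) (hq₁ : q₁ ≤ 3 * t) (hq₂ : q₂ ≤ 3 * t)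
    (h₁ : p₁ ≤ q₁ + 1 ∧ q₁ ≤ p₁ + 1) (h₂ : p₂ ≤ q₂ + 1 ∧ q₂ ≤ p₂ + 1) :
    HasColumnCover t p₁ q₁ p₂ q₂ ∨ HasColumnCover t q₁ p₁ q₂ p₂ := by
  by_cases hm₁ : p₁ % 3 = 0 <;> by_cases hm₂ : p₂ % 3 = 0
  · exact .inl (hasColumnCover_pair_of_mod_eq_zero ht hm₁ hm₂)
  · exact hasColumnCover_or_flip_of_mod ht hp₁ hp₂ hq₁ h₁ h₂ hm₁
  · exact (hasColumnCover_or_flip_of_mod ht hp₂ hp₁ hq₂ h₂ h₁ hm₂).imp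
      HasColumnCover.symm HasColumnCover.symm
  · exact .inl (hasColumnCover_pair_of_mod_ne_zero ht hm₁ hm₂)

namespace SimpleGraph

/-! ### Domination number and packings -/

section Domination

variable {V : Type*}

theorem IsDominatingSet.dominationNumber_le [Fintype V] {G : SimpleGraph V} {D : Finset V}
    (h : G.IsDominatingSet D) : G.dominationNumber ≤ D.card :=
  Nat.sInf_le ⟨D, h, rfl⟩

theorem exists_isDominatingSet_card_eq [Fintype V] (G : SimpleGraph V) :
    ∃ D : Finset V, G.IsDominatingSet D ∧ D.card = G.dominationNumber :=
  Nat.sInf_mem (s := {k : ℕ | ∃ D : Finset V, G.IsDominatingSet D ∧ D.card = k})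
    ⟨_, Finset.univ, fun v => .inl (Finset.mem_univ v), rfl⟩

/-- A family of vertices with pairwise disjoint closed neighbourhoods bounds the domination
number from below. -/
theorem card_le_dominationNumber [Fintype V] {ι : Type*} [Fintype ι] {G : SimpleGraph V}
    (f : ι → V)
    (hf : ∀ i j u, (u = f i ∨ G.Adj u (f i)) → (u = f j ∨ G.Adj u (f j)) → i = j) :
    Fintype.card ι ≤ G.dominationNumber := by
  obtain ⟨D, hD, hcard⟩ := G.exists_isDominatingSet_card_eq
  have h : ∀ i, ∃ u ∈ D, u = f i ∨ G.Adj u (f i) := fun i =>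
    (hD (f i)).elim (fun h => ⟨f i, h, .inl rfl⟩) fun ⟨u, hu, h⟩ => ⟨u, hu, .inr h⟩
  choose g hgD hg using h
  rw [← hcard, ← Finset.card_univ]
  refine Finset.card_le_card_of_injOn g (fun i _ => hgD i) fun i _ j _ hij => ?_
  exact hf i j (g i) (hg i) (hij ▸ hg j)

end Domination

/-! ### Deleting at most two edges -/

section PathProduct

variable {n m : ℕ}

theorem strongProduct_pathGraph_adj {x y : Fin n × Fin m} :
    ((pathGraph n).strongProduct (pathGraph m)).Adj x y ↔ x ≠ y ∧
      (x.1 : ℕ) ≤ y.1 + 1 ∧ (y.1 : ℕ) ≤ x.1 + 1 ∧ (x.2 : ℕ) ≤ y.2 + 1 ∧ (y.2 : ℕ) ≤ x.2 + 1 := by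
  simp only [strongProduct, pathGraph_adj, ne_eq, Prod.ext_iff, Fin.ext_iff]
  omega

/-- The strip of rows within distance `1` of row `c` can be dominated by `t + 1` vertices of
row `c` without using edges from `F`. -/
def StripCover (t : ℕ) (F : Finset (Sym2 (Fin n × Fin m))) (c : ℕ) : Prop :=
  ∃ d : ℕ → ℕ, (∀ i ≤ t, d i ≤ 3 * t) ∧ ∀ v : Fin n × Fin m, ∃ i ≤ t,
    d i ≤ (v.1 : ℕ) + 1 ∧ (v.1 : ℕ) ≤ d i + 1 ∧
      ∀ x : Fin n × Fin m, (x.1 : ℕ) = d i → (x.2 : ℕ) = c → s(x, v) ∉ F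

theorem stripCover_of_hasColumnCover {t p₁ q₁ p₂ q₂ c : ℕ}
    {F : Finset (Sym2 (Fin n × Fin m))} (hn : n = 3 * t + 1)
    (h : HasColumnCover t p₁ q₁ p₂ q₂)
    (hF : ∀ x v : Fin n × Fin m, (x.2 : ℕ) = c → s(x, v) ∈ F →
      ((x.1 : ℕ) = p₁ ∧ (v.1 : ℕ) = q₁) ∨ ((x.1 : ℕ) = p₂ ∧ (v.1 : ℕ) = q₂)) :
    StripCover t F c := by
  obtain ⟨d, hd, h⟩ := h
  refine ⟨d, hd, fun v => ?_⟩
  obtain ⟨i, hi, h₁, h₂, h₃, h₄⟩ := h v.1 (by omega)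
  refine ⟨i, hi, h₁, h₂, fun x hx hxc hxF => ?_⟩
  rcases hF x v hxc hxF with h | h
  · exact h₃ (hx ▸ h)
  · exact h₄ (hx ▸ h)

theorem stripCover_of_subsingleton {t c : ℕ} {F : Finset (Sym2 (Fin n × Fin m))} (ht : 1 ≤ t)
    (hn : n = 3 * t + 1)
    (hF : (F : Set (Sym2 (Fin n × Fin m))) ⊆
      ((pathGraph n).strongProduct (pathGraph m)).edgeSet)
    (h : ∀ e ∈ F, ∀ f ∈ F, (∃ x ∈ e, (x.2 : ℕ) = c) → (∃ x ∈ f, (x.2 : ℕ) = c) → e = f) :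
    StripCover t F c := by
  by_cases hc : ∃ x v : Fin n × Fin m, (x.2 : ℕ) = c ∧ s(x, v) ∈ F
  · obtain ⟨x, v, hx, hxv⟩ := hc
    have hadj := strongProduct_pathGraph_adj.1 (mem_edgeSet _ |>.1 (hF hxv))
    have huniq : ∀ y w : Fin n × Fin m, (y.2 : ℕ) = c → s(y, w) ∈ F →
        (y = x ∧ w = v) ∨ (y = v ∧ w = x) := fun y w hy hyw => by
      simpa using h _ hyw _ hxv ⟨y, by simp, hy⟩ ⟨x, by simp, hx⟩
    by_cases hv : (v.2 : ℕ) = c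
    -- An edge inside row `c` is forbidden in both directions.
    · have hne : (x.1 : ℕ) ≠ v.1 := fun h' =>
        hadj.1 (Prod.ext (Fin.ext h') (Fin.ext (hx.trans hv.symm)))
      refine stripCover_of_hasColumnCover hn
        (hasColumnCover_swap (p := x.1) (q := v.1) ht (by omega) (by omega) (by omega))
        fun y w hy hyw => ?_
      rcases huniq y w hy hyw with ⟨rfl, rfl⟩ | ⟨rfl, rfl⟩ <;> simp
    · refine stripCover_of_hasColumnCover hn (hasColumnCover_single x.1 v.1 ht)
        fun y w hy hyw => ?_
      rcases huniq y w hy hyw with ⟨rfl, rfl⟩ | ⟨rfl, rfl⟩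
      · simp
      · exact absurd hy hv
  · exact stripCover_of_hasColumnCover hn (hasColumnCover_single 0 0 ht)
      fun x v hx hxv => absurd ⟨x, v, hx, hxv⟩ hc

theorem exists_eq_mk_of_rows {c : ℕ} {e : Sym2 (Fin n × Fin m)}
    (h₀ : ∃ x ∈ e, (x.2 : ℕ) = c) (h₁ : ∃ x ∈ e, (x.2 : ℕ) = c + 1) :
    ∃ x y : Fin n × Fin m, e = s(x, y) ∧ (x.2 : ℕ) = c ∧ (y.2 : ℕ) = c + 1 := by
  obtain ⟨x, hx, hxc⟩ := h₀
  obtain ⟨y, hy, hyc⟩ := h₁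
  have hne : x ≠ y := by rintro rfl; omega
  exact ⟨x, y, (Sym2.mem_and_mem_iff hne).1 ⟨hx, hy⟩, hxc, hyc⟩

theorem stripCover_or_stripCover_succ {t c : ℕ} {e f : Sym2 (Fin n × Fin m)} (ht : 1 ≤ t)
    (hn : n = 3 * t + 1)
    (he : e ∈ ((pathGraph n).strongProduct (pathGraph m)).edgeSet)
    (hf : f ∈ ((pathGraph n).strongProduct (pathGraph m)).edgeSet)
    (he₀ : ∃ x ∈ e, (x.2 : ℕ) = c) (he₁ : ∃ x ∈ e, (x.2 : ℕ) = c + 1)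
    (hf₀ : ∃ x ∈ f, (x.2 : ℕ) = c) (hf₁ : ∃ x ∈ f, (x.2 : ℕ) = c + 1) :
    StripCover t {e, f} c ∨ StripCover t {e, f} (c + 1) := by
  obtain ⟨x, y, rfl, hx, hy⟩ := exists_eq_mk_of_rows he₀ he₁
  obtain ⟨z, w, rfl, hz, hw⟩ := exists_eq_mk_of_rows hf₀ hf₁
  have hxy := strongProduct_pathGraph_adj.1 (mem_edgeSet _ |>.1 he)
  have hzw := strongProduct_pathGraph_adj.1 (mem_edgeSet _ |>.1 hf)
  refine (hasColumnCover_or_flip (p₁ := x.1) (q₁ := y.1) (p₂ := z.1) (q₂ := w.1) ht (by omega)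
    (by omega) (by omega) (by omega) (by omega) (by omega)).imp (fun h => ?_) fun h => ?_
  all_goals
    refine stripCover_of_hasColumnCover hn h fun u v hu huv => ?_
    simp only [Finset.mem_insert, Finset.mem_singleton, Sym2.eq_iff] at huv
    rcases huv with (⟨rfl, rfl⟩ | ⟨rfl, rfl⟩) | (⟨rfl, rfl⟩ | ⟨rfl, rfl⟩)
    all_goals omega

theorem forall_mem_row_of_not_stripCover {t c : ℕ} {F : Finset (Sym2 (Fin n × Fin m))} (ht : 1 ≤ t)
    (hn : n = 3 * t + 1)
    (hF : (F : Set (Sym2 (Fin n × Fin m))) ⊆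
      ((pathGraph n).strongProduct (pathGraph m)).edgeSet)
    (hcard : F.card ≤ 2) (h : ¬ StripCover t F c) :
    F.card = 2 ∧ ∀ e ∈ F, ∃ x ∈ e, (x.2 : ℕ) = c := by
  have h' := mt (stripCover_of_subsingleton ht hn hF) h
  push Not at h'
  obtain ⟨e, he, f, hf, hec, hfc, hef⟩ := h'
  have hsub : {e, f} ⊆ F := by simp [Finset.insert_subset_iff, he, hf]
  have heq : {e, f} = F := Finset.eq_of_subset_of_card_le hsub (by
    rw [Finset.card_pair hef]; exact hcard)
  subst heq
  refine ⟨Finset.card_pair hef, ?_⟩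
  simp only [Finset.mem_insert, Finset.mem_singleton, forall_eq_or_imp, forall_eq]
  exact ⟨hec, hfc⟩

theorem forall_stripCover_or_forall_stripCover_succ {t : ℕ}
    {F : Finset (Sym2 (Fin n × Fin m))} (ht : 1 ≤ t) (hn : n = 3 * t + 1)
    (hF : (F : Set (Sym2 (Fin n × Fin m))) ⊆
      ((pathGraph n).strongProduct (pathGraph m)).edgeSet)
    (hcard : F.card ≤ 2) :
    (∀ j, StripCover t F (3 * j)) ∨ ∀ j, StripCover t F (3 * j + 1) := by
  by_contra! hcon
  obtain ⟨⟨j, hj⟩, k, hk⟩ := hcon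
  obtain ⟨h2, hj'⟩ := forall_mem_row_of_not_stripCover ht hn hF hcard hj
  obtain ⟨-, hk'⟩ := forall_mem_row_of_not_stripCover ht hn hF hcard hk
  obtain ⟨e, f, -, rfl⟩ := Finset.card_eq_two.1 h2
  have he : e ∈ ({e, f} : Finset (Sym2 (Fin n × Fin m))) := by simp
  have hf : f ∈ ({e, f} : Finset (Sym2 (Fin n × Fin m))) := by simp
  -- Each edge meets rows `3 j` and `3 k + 1`, whose distance is at most `1` only if `j = k`.
  have hjk : j = k := by
    obtain ⟨x, hx, hxj⟩ := hj' e he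
    obtain ⟨y, hy, hyk⟩ := hk' e he
    have hne : x ≠ y := by rintro rfl; omega
    obtain rfl := (Sym2.mem_and_mem_iff hne).1 ⟨hx, hy⟩
    have := strongProduct_pathGraph_adj.1 (mem_edgeSet _ |>.1 (hF he))
    omega
  subst hjk
  exact (stripCover_or_stripCover_succ ht hn (hF he) (hF hf) (hj' e he) (hk' e he) (hj' f hf)
    (hk' f hf)).elim hj hk

theorem dominationNumber_deleteEdges_le_of_stripCover {t r : ℕ}
    {F : Finset (Sym2 (Fin n × Fin m))} (hn : n = 3 * t + 1) (c : ℕ → ℕ)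
    (hc : ∀ j ≤ r, c j < m)
    (hrow : ∀ b < m, ∃ j ≤ r, c j ≤ b + 1 ∧ b ≤ c j + 1)
    (h : ∀ j, StripCover t F (c j)) :
    (((pathGraph n).strongProduct (pathGraph m)).deleteEdges
      (F : Set (Sym2 (Fin n × Fin m)))).dominationNumber ≤ (t + 1) * (r + 1) := by
  classical
  choose d hd h using h
  let g : Fin (t + 1) × Fin (r + 1) → Fin n × Fin m := fun p =>
    (⟨d p.2 p.1, by have := hd p.2 p.1 (by omega); omega⟩, ⟨c p.2, hc _ (by omega)⟩)
  have hdom : (((pathGraph n).strongProduct (pathGraph m)).deleteEdges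
      (F : Set (Sym2 (Fin n × Fin m)))).IsDominatingSet (Finset.univ.image g) := by
    intro v
    obtain ⟨j, hj, hj₁, hj₂⟩ := hrow v.2 v.2.isLt
    obtain ⟨i, hi, hi₁, hi₂, hiF⟩ := h j v
    let p : Fin (t + 1) × Fin (r + 1) := (⟨i, by omega⟩, ⟨j, by omega⟩)
    have hp : g p ∈ Finset.univ.image g := Finset.mem_image_of_mem g (Finset.mem_univ p)
    by_cases hv : g p = v
    · exact .inl (hv ▸ hp)
    · refine .inr ⟨g p, hp, ?_⟩
      rw [deleteEdges_adj]
      exact ⟨strongProduct_pathGraph_adj.2 ⟨hv, hi₁, hi₂, hj₁, hj₂⟩, hiF _ rfl rfl⟩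
  refine hdom.dominationNumber_le.trans (Finset.card_image_le.trans ?_)
  simp

theorem dominationNumber_deleteEdges_le {t r : ℕ} {F : Finset (Sym2 (Fin n × Fin m))}
    (ht : 1 ≤ t) (hn : n = 3 * t + 1) (hm : m = 3 * r + 2)
    (hF : (F : Set (Sym2 (Fin n × Fin m))) ⊆
      ((pathGraph n).strongProduct (pathGraph m)).edgeSet)
    (hcard : F.card ≤ 2) :
    (((pathGraph n).strongProduct (pathGraph m)).deleteEdges
      (F : Set (Sym2 (Fin n × Fin m)))).dominationNumber ≤ (t + 1) * (r + 1) := by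
  rcases forall_stripCover_or_forall_stripCover_succ ht hn hF hcard with h | h
  · exact dominationNumber_deleteEdges_le_of_stripCover hn (fun j => 3 * j)
      (fun j hj => by omega) (fun b hb => ⟨(b + 1) / 3, by omega, by omega, by omega⟩) h
  · exact dominationNumber_deleteEdges_le_of_stripCover hn (fun j => 3 * j + 1)
      (fun j hj => by omega) (fun b hb => ⟨b / 3, by omega, by omega, by omega⟩) h

/-! ### The packing and the isolated corner -/

/-- The vertices `(3 i, 3 j + 1)`. -/
def packing (t r : ℕ) (p : Fin (t + 1) × Fin (r + 1)) :
    Fin (3 * t + 1) × Fin (3 * r + 2) :=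
  (⟨3 * p.1, by omega⟩, ⟨3 * p.2 + 1, by omega⟩)

theorem packing_disjoint {t r : ℕ} (p q : Fin (t + 1) × Fin (r + 1))
    (u : Fin (3 * t + 1) × Fin (3 * r + 2))
    (hp : u = packing t r p ∨
      ((pathGraph _).strongProduct (pathGraph _)).Adj u (packing t r p))
    (hq : u = packing t r q ∨
      ((pathGraph _).strongProduct (pathGraph _)).Adj u (packing t r q)) : p = q := by
  simp only [strongProduct_pathGraph_adj, packing, Prod.ext_iff, Fin.ext_iff] at hp hq
  ext <;> omega

theorem le_dominationNumber_strongProduct_pathGraph (t r : ℕ) :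
    (t + 1) * (r + 1) ≤ ((pathGraph (3 * t + 1)).strongProduct
      (pathGraph (3 * r + 2))).dominationNumber := by
  simpa using card_le_dominationNumber _ packing_disjoint

theorem lt_dominationNumber_of_corner_isolated {t r : ℕ}
    {F : Set (Sym2 (Fin (3 * t + 1) × Fin (3 * r + 2)))}
    (hF : ∀ u, ((pathGraph (3 * t + 1)).strongProduct (pathGraph (3 * r + 2))).Adj u (0, 0) →
      s(u, (0, 0)) ∈ F) :
    (t + 1) * (r + 1) < (((pathGraph (3 * t + 1)).strongProduct
      (pathGraph (3 * r + 2))).deleteEdges F).dominationNumber := by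
  have hcorner : ∀ p, packing t r p ≠ (0, 0) := fun p h => by
    have h' : 3 * (p.2 : ℕ) + 1 = 0 := congrArg (fun z => (z.2 : ℕ)) h
    omega
  have hnot : ∀ u, ¬ (((pathGraph (3 * t + 1)).strongProduct
      (pathGraph (3 * r + 2))).deleteEdges F).Adj u (0, 0) := fun u h =>
    (deleteEdges_adj.1 h).2 (hF u (deleteEdges_adj.1 h).1)
  have key := card_le_dominationNumber
    (G := ((pathGraph (3 * t + 1)).strongProduct (pathGraph (3 * r + 2))).deleteEdges F)
    (fun o : Option (Fin (t + 1) × Fin (r + 1)) => o.elim (0, 0) (packing t r)) ?_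
  · simpa using key
  rintro (_ | p) (_ | q) u hp hq
  · rfl
  · obtain rfl := hp.resolve_right (hnot u)
    rcases hq with hq | hq
    · exact absurd hq.symm (hcorner q)
    · exact absurd hq.symm (hnot _)
  · obtain rfl := hq.resolve_right (hnot u)
    rcases hp with hp | hp
    · exact absurd hp.symm (hcorner p)
    · exact absurd hp.symm (hnot _)
  · exact congrArg some (packing_disjoint p q u (hp.imp id fun h => (deleteEdges_adj.1 h).1)
      (hq.imp id fun h => (deleteEdges_adj.1 h).1))

theorem exists_corner_edges {t r : ℕ} (ht : 1 ≤ t) :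
    ∃ F : Finset (Sym2 (Fin (3 * t + 1) × Fin (3 * r + 2))),
      (F : Set _) ⊆ ((pathGraph (3 * t + 1)).strongProduct (pathGraph (3 * r + 2))).edgeSet ∧
      F.card = 3 ∧
      ∀ u, ((pathGraph (3 * t + 1)).strongProduct (pathGraph (3 * r + 2))).Adj u (0, 0) →
        s(u, (0, 0)) ∈ F := by
  let x : Fin (3 * t + 1) := ⟨1, by omega⟩
  let y : Fin (3 * r + 2) := ⟨1, by omega⟩
  have hx : x ≠ 0 := by simp [x, Fin.ext_iff]
  have hy : y ≠ 0 := by simp [y]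
  refine ⟨{s((x, 0), (0, 0)), s((0, y), (0, 0)), s((x, y), (0, 0))}, ?_, ?_, fun u hu => ?_⟩
  · simp [Set.insert_subset_iff, strongProduct_pathGraph_adj, hx, x, y]
  · rw [Finset.card_eq_three]
    exact ⟨_, _, _, by simp [hx], by simp [hy.symm], by simp [hx.symm], rfl⟩
  · obtain ⟨a, b⟩ := u
    simp only [strongProduct_pathGraph_adj, ne_eq, Prod.ext_iff, Fin.ext_iff, Fin.val_zero] at hu
    have ha : a = 0 ∨ a = x := by simp only [Fin.ext_iff, x, Fin.val_zero]; omega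
    have hb : b = 0 ∨ b = y := by simp only [Fin.ext_iff, y, Fin.val_zero]; omega
    rcases ha with rfl | rfl <;> rcases hb with rfl | rfl
    · simp at hu
    all_goals simp

end PathProduct

end SimpleGraph

theorem mainTheorem1 (n m t r : ℕ) (hn2 : 2 ≤ n) (hm2 : 2 ≤ m)
    (hn : n = 3 * t + 1) (hm : m = 3 * r + 2) :
    ((SimpleGraph.pathGraph n).strongProduct (SimpleGraph.pathGraph m)).bondageNumber = 3 := by
  have ht : 1 ≤ t := by omega
  subst hn hm
  have hle := SimpleGraph.le_dominationNumber_strongProduct_pathGraph t r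
  have hge : ((SimpleGraph.pathGraph (3 * t + 1)).strongProduct
      (SimpleGraph.pathGraph (3 * r + 2))).dominationNumber ≤ (t + 1) * (r + 1) := by
    -- Deleting no edge bounds `γ` of the product itself.
    simpa using SimpleGraph.dominationNumber_deleteEdges_le (F := ∅) ht rfl
      (rfl : 3 * r + 2 = _) (by simp) (by simp)
  obtain ⟨F, hF, hcard, hcorner⟩ := SimpleGraph.exists_corner_edges (r := r) ht
  have hlt := hge.trans_lt (SimpleGraph.lt_dominationNumber_of_corner_isolated hcorner)
  refine le_antisymm (Nat.sInf_le ⟨F, hF, hlt, hcard⟩) (le_csInf ⟨3, F, hF, hlt, hcard⟩ ?_)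
  rintro k ⟨F', hF', hlt, rfl⟩
  by_contra! hk
  exact absurd (SimpleGraph.dominationNumber_deleteEdges_le ht rfl rfl hF' (by omega))
    (not_le.2 (hle.trans_lt hlt))
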